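/- Let $n\ge 2$, let $f_1,\dots,f_m\in\mathbb{Q}[x_1,\dots,x_n]$ be not all zero, and let $V=\{x\in\mathbb{C}^n : f_1(x)=\dots=f_m(x)=0\}$. For every integer $j\ge 0$ let $V_j$ be the union of the irreducible components of $V$ of dimension $j$ (so $V=\bigcup_{j=0}^{n-1}V_j$). Let $\mathcal{P}\subset V$ be a finite set, and for every $p\in\mathcal{P}$ let $\theta_p\in\mathbb{C}$, with $\theta_p\neq\theta_{p'}$ for $p\neq p'$. Let $\ell_1,\dots,\ell_{n-1}\in\mathbb{Q}[x_1,\dots,x_n]$ be affine linear polynomials (degree at most $1$). For $1\le k\le n-1$ and $p\in\mathcal{P}$ put $$L_1^{(k)}=\{x\in\mathbb{C}^n : \ell_i(x)=0,\ 1\le i\le k\},\qquad L_{0,p}^{(k)}=\{x\in\mathbb{C}^n : \ell_i(x)-\ell_i(p)=0,\ 1\le i\le k\},$$ and consider the conditions * (H1) $V_j\cap L_1^{(k)}$ is empty or equidimensional of dimension $j-k$ for all $j\ge k$, and $V_j\cap L_1^{(k)}=\emptyset$ for all $j<k$; * (H2) $V_k\cap\bigl(\bigcup_{j>k}V_j\bigr)\cap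 L_1^{(k)}=\emptyset$; * (H3) $V_j\cap L_{0,p}^{(k)}$ is empty or equidimensional of dimension $j-k$ for all $j\ge k$, and $V_j\cap L_{0,p}^{(k)}$ is empty or equal to $\{p\}$ for all $j<k$; * (H4) $p'\notin L_{0,p}^{(k)}$ for all $p'\in\mathcal{P}$ with $p'\ne p$. Assume that $\ell_1,\dots,\ell_{n-1}$ are generic in the following sense: (i) there is a Zariski open subset $U$ of the space $\mathbb{C}^{(n-1)(n+1)}$ of coefficients of $(n-1)$-tuples of complex affine linear polynomials, containing the coefficients of $(\ell_1,\dots,\ell_{n-1})$, such that (H1) and (H2) hold for every $1\le k\le n-1$ and every tuple with coefficients in $U$; (ii) (H3) and (H4) hold for $\ell_1,\dots,\ell_{n-1}$, for every $1\le k\le n-1$ and every $p\in\mathcal{P}$. For $1\le k\le n-1$ and $p\in\mathcal{P}$, let $\mathcal{Z}_p^{(k)}\subset\mathbb{C}^{n+2}$ be the union of the irreducible components $C$ of $$\{(\theta_p,x,s) : x\in V,\ s\in\mathbb{C},\ \ell_i(x)-(1-s)\,\ell_i(p)=0 \text{ for } 1\le i\le k\}$$ whose image under $(\theta,x,s)\mapsto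 s$ is Zariski dense in $\mathbb{C}$, and let $\mathcal{Z}_{\mathcal{P}}^{(k)}=\bigcup_{p\in\mathcal{P}}\mathcal{Z}_p^{(k)}$. Let $\Pi:\mathbb{C}^{n+2}\to\mathbb{C}^{n+1}$ be the projection $(\theta,x,s)\mapsto(x,s)$. Then for every $p\in\mathcal{P}$: * $p\in V_{n-1}$ if and only if $(p,0)\in\Pi\bigl(\mathcal{Z}_{\mathcal{P}}^{(n-1)}\bigr)$; * for every $1\le k\le n-1$, if $p\notin\bigcup_{j>k}V_j$, then $p\in V_k$ if and only if $(p,0)\in\Pi\bigl(\mathcal{Z}_{\mathcal{P}}^{(k)}\bigr)$. -/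

import Mathlib

namespace WitnessPoints

open MvPolynomial

noncomputable section

/-- The Zariski topology on the affine space `𝔸^σ = (σ → ℂ)`: the closed sets are the common
zero sets of families of polynomials. -/
@[reducible] def zariski (σ : Type*) : TopologicalSpace (σ → ℂ) :=
  TopologicalSpace.ofClosed
    {Z | ∃ S : Set (MvPolynomial σ ℂ), Z = {x | ∀ g ∈ S, eval x g = 0}}
    ⟨{1}, by ext x; simp⟩
    (by
      intro A hA
      refine ⟨{g | ∃ Z ∈ A, ∀ x ∈ Z, eval x g = 0}, ?_⟩
      ext x
      constructor
      · rintro hx g ⟨Z, hZ, hg⟩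
        exact hg x (hx Z hZ)
      · intro hx Z hZ
        obtain ⟨S, rfl⟩ := hA hZ
        exact fun g hg => hx g ⟨_, hZ, fun y hy => hy g hg⟩)
    (by
      rintro _ ⟨S, rfl⟩ _ ⟨T, rfl⟩
      refine ⟨{g | ∃ a ∈ S, ∃ b ∈ T, g = a * b}, ?_⟩
      ext x
      constructor
      · rintro (hx | hx) g ⟨a, ha, b, hb, rfl⟩
        · simp [hx a ha]
        · simp [hx b hb]
      · intro hx
        by_contra hne
        simp only [Set.mem_union, Set.mem_ofPred_eq, not_or, not_forall] at hne
        obtain ⟨⟨a, ha, hax⟩, ⟨b, hb, hbx⟩⟩ := hne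
        have h := hx (a * b) ⟨a, ha, b, hb, rfl⟩
        rw [map_mul] at h
        exact (mul_ne_zero hax hbx) h)

variable {σ : Type*}

/-- The irreducible components of a subset `S` of affine space: its maximal irreducible subsets
for the Zariski topology. -/
def components (S : Set (σ → ℂ)) : Set (Set (σ → ℂ)) :=
  {C | Maximal (fun D => D ⊆ S ∧ @IsIrreducible _ (zariski σ) D) C}

/-- The dimension of a variety: the Krull dimension of its coordinate ring. -/
def dim (W : Set (σ → ℂ)) : WithBot ℕ∞ :=
  ringKrullDim (MvPolynomial σ ℂ ⧸ vanishingIdeal ℂ W)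

/-- The equidimensional component `V_k`: the union of the irreducible components of `V` of
dimension `k`. -/
def equiComponent (V : Set (σ → ℂ)) (k : ℕ) : Set (σ → ℂ) :=
  ⋃₀ {W | W ∈ components V ∧ dim W = k}

/-- `S` is empty or `d`-equidimensional. -/
def EmptyOrEquidim (S : Set (σ → ℂ)) (d : ℕ) : Prop :=
  S = ∅ ∨ ∀ C ∈ components S, dim C = d

variable {n m : ℕ}

/-- The affine variety in `ℂ^n` defined by rational polynomials. -/
def variety (f : Fin m → MvPolynomial (Fin n) ℚ) : Set (Fin n → ℂ) :=
  {x | ∀ j, aeval x (f j) = 0}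

/-- A family of `n - 1` affine linear polynomials in `n` variables is given by its coefficients
`a`: the entry `(i, 0)` is the constant term of the `i`-th polynomial, and the entry `(i, j + 1)`
is its coefficient at the `j`-th variable. This is the value at `x` of the `i`-th polynomial. -/
def linVal (a : Fin (n - 1) × Fin (n + 1) → ℂ) (i : Fin (n - 1)) (x : Fin n → ℂ) : ℂ :=
  a (i, 0) + ∑ j : Fin n, a (i, j.succ) * x j

/-- The linear variety on which the first `k` polynomials of the family vanish. -/
def linOne (a : Fin (n - 1) × Fin (n + 1) → ℂ) (k : ℕ) : Set (Fin n → ℂ) :=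
  {x | ∀ i : Fin (n - 1), i.val < k → linVal a i x = 0}

/-- The linear variety through `p` on which the first `k` polynomials of the family take the same
values as at `p`. -/
def linZero (a : Fin (n - 1) × Fin (n + 1) → ℂ) (k : ℕ) (p : Fin n → ℂ) : Set (Fin n → ℂ) :=
  {x | ∀ i : Fin (n - 1), i.val < k → linVal a i x - linVal a i p = 0}

/-- Condition (H1) for the first `k` polynomials. -/
def H1 (V : Set (Fin n → ℂ)) (a : Fin (n - 1) × Fin (n + 1) → ℂ) (k : ℕ) : Prop :=
  (∀ j, k ≤ j → EmptyOrEquidim (equiComponent V j ∩ linOne a k) (j - k)) ∧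
  ∀ j < k, equiComponent V j ∩ linOne a k = ∅

/-- Condition (H2) for the first `k` polynomials. -/
def H2 (V : Set (Fin n → ℂ)) (a : Fin (n - 1) × Fin (n + 1) → ℂ) (k : ℕ) : Prop :=
  equiComponent V k ∩ (⋃ j > k, equiComponent V j) ∩ linOne a k = ∅

/-- Condition (H3) for the first `k` polynomials and the point `p`. -/
def H3 (V : Set (Fin n → ℂ)) (a : Fin (n - 1) × Fin (n + 1) → ℂ) (k : ℕ) (p : Fin n → ℂ) : Prop :=
  (∀ j, k ≤ j → EmptyOrEquidim (equiComponent V j ∩ linZero a k p) (j - k)) ∧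
  ∀ j < k, equiComponent V j ∩ linZero a k p = ∅ ∨ equiComponent V j ∩ linZero a k p = {p}

/-- Condition (H4) for the first `k` polynomials, the finite set `P` and the point `p`. -/
def H4 (P : Finset (Fin n → ℂ)) (a : Fin (n - 1) × Fin (n + 1) → ℂ) (k : ℕ) (p : Fin n → ℂ) :
    Prop :=
  ∀ p' ∈ P, p' ≠ p → p' ∉ linZero a k p

/-- The genericity assumptions on the family `ℓ_1, …, ℓ_{n-1}` with coefficients `a`: the
coefficients lie in a Zariski open set of the coefficient space on which (H1) and (H2) hold, and
(H3) and (H4) hold at every point of `P`; everything for every `1 ≤ k ≤ n - 1`. -/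
structure Generic (V : Set (Fin n → ℂ)) (P : Finset (Fin n → ℂ))
    (a : Fin (n - 1) × Fin (n + 1) → ℂ) : Prop where
  h12 : ∃ U : Set (Fin (n - 1) × Fin (n + 1) → ℂ), @IsOpen _ (zariski _) U ∧ a ∈ U ∧
    ∀ b ∈ U, ∀ k, 1 ≤ k → k ≤ n - 1 → H1 V b k ∧ H2 V b k
  h3 : ∀ p ∈ P, ∀ k, 1 ≤ k → k ≤ n - 1 → H3 V a k p
  h4 : ∀ p ∈ P, ∀ k, 1 ≤ k → k ≤ n - 1 → H4 P a k p

/-- The point `(x, s)` of `𝔸^{n+1}`. -/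
def pair (x : Fin n → ℂ) (s : ℂ) : Fin (n + 1) → ℂ :=
  Fin.snoc (α := fun _ => ℂ) x s

/-- The point `(θ, x, s)` of `𝔸^{n+2}`. -/
def triple (θ : ℂ) (x : Fin n → ℂ) (s : ℂ) : Fin (n + 2) → ℂ :=
  Fin.cons (α := fun _ => ℂ) θ (pair x s)

/-- The projection `π_s` onto the last coordinate, with values in `𝔸^1`. -/
def projS (c : Fin (n + 2) → ℂ) : Fin 1 → ℂ :=
  fun _ => c (Fin.last (n + 1))

/-- The projection `Π : (θ, x, s) ↦ (x, s)`. -/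
def projPi (c : Fin (n + 2) → ℂ) : Fin (n + 1) → ℂ :=
  fun i => c i.succ

/-- `{θ_p} × V × 𝔸^1`. -/
def hatV (V : Set (Fin n → ℂ)) (θp : ℂ) : Set (Fin (n + 2) → ℂ) :=
  {c | ∃ x s, c = triple θp x s ∧ x ∈ V}

/-- `{θ_p} × {(x, s) | ℓ_i(x) - (1 - s) ℓ_i(p) = 0 for 1 ≤ i ≤ k}`. -/
def calL (a : Fin (n - 1) × Fin (n + 1) → ℂ) (k : ℕ) (p : Fin n → ℂ) (θp : ℂ) :
    Set (Fin (n + 2) → ℂ) :=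
  {c | ∃ x s, c = triple θp x s ∧
    ∀ i : Fin (n - 1), i.val < k → linVal a i x - (1 - s) * linVal a i p = 0}

/-- `Z_p^{(k)}`: the union of the irreducible components of the intersection of the two previous
sets that project dominantly onto the `s`-line. -/
def Zpt (V : Set (Fin n → ℂ)) (a : Fin (n - 1) × Fin (n + 1) → ℂ) (k : ℕ) (p : Fin n → ℂ)
    (θp : ℂ) : Set (Fin (n + 2) → ℂ) :=
  ⋃₀ {C | C ∈ components (hatV V θp ∩ calL a k p θp) ∧
    @closure _ (zariski (Fin 1)) (projS '' C) = Set.univ}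

/-- `Z_P^{(k)}`: the union of the `Z_p^{(k)}` over the points `p` of `P`. -/
def Zset (V : Set (Fin n → ℂ)) (P : Finset (Fin n → ℂ)) (θ : (Fin n → ℂ) → ℂ)
    (a : Fin (n - 1) × Fin (n + 1) → ℂ) (k : ℕ) : Set (Fin (n + 2) → ℂ) :=
  ⋃ p ∈ P, Zpt V a k p (θ p)

end

end WitnessPoints

/-!
Fix `p ∈ P` and consider the homotopy `ℓ_i(x) = (1 - s) ℓ_i(p)`, `i ≤ k`, on `V`, which moves the
generic linear section at `s = 1` to the linear section through `p` at `s = 0`. By `H4`, a point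
`(p, 0)` of the projected set can only come from the homotopy attached to `p` itself
(`pair_mem_projPi_Zset_iff`), so two implications remain.

If `p` lies on a component `W` of dimension `k`, then `W × 𝔸¹` has dimension at least `k + 1`, and
the `k` equations of the homotopy cut out an irreducible set through `(p, 0)` that is not a point
(`exists_isIrreducible_ne_singleton`). This rests on Krull's height theorem and on the fact that
all maximal ideals of a finitely generated domain have height equal to its dimension; the
inequality that is needed, `ringKrullDim_le_height_of_isMaximal`, follows from Noether
normalization and going down. If the irreducible set did not dominate the `s`-line, it would lie in
`s = 0` (`last_eq_zero_of_not_dense`), hence over `V_k ∩ L_{0,p}`, whose components are points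
by `H3`.

Conversely, let `(p, 0)` lie on a component that dominates the `s`-line. Its `x`-projection is
irreducible, hence contained in a component `W ∋ p` of `V`. For fixed `s` the homotopy is the
family of linear polynomials whose constant terms are shifted by `-(1 - s) ℓ_i(p)`; at `s = 1` it is
the given generic family, so for almost all `s` it belongs to the open set on which `H1` holds. As
some of these `s` are attained, `H1` forces `dim W ≥ k`
(`exists_mem_equiComponent_of_triple_mem_Zpt`). Components of larger dimension are excluded by
assumption, or, for `k = n - 1`, because `V` is a proper subset of `𝔸ⁿ`.
-/

namespace WitnessPoints

open MvPolynomial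

/-! ### Zariski closed and irreducible sets -/

section Zariski

variable {σ τ : Type*}

lemma mem_vanishingIdeal {D : Set (σ → ℂ)} {g : MvPolynomial σ ℂ} :
    g ∈ vanishingIdeal ℂ D ↔ ∀ x ∈ D, eval x g = 0 := by
  simp [mem_vanishingIdeal_iff, aeval_eq_eval]

lemma mem_zeroLocus {I : Ideal (MvPolynomial σ ℂ)} {x : σ → ℂ} :
    x ∈ zeroLocus ℂ I ↔ ∀ g ∈ I, eval x g = 0 := by
  simp [mem_zeroLocus_iff, aeval_eq_eval]

lemma isClosed_zariski_iff {Z : Set (σ → ℂ)} :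
    @IsClosed _ (zariski σ) Z ↔ ∃ S : Set (MvPolynomial σ ℂ), Z = {x | ∀ g ∈ S, eval x g = 0} := by
  rw [← @isOpen_compl_iff _ _ (zariski σ)]
  change Zᶜᶜ ∈ _ ↔ _
  rw [compl_compl]
  rfl

lemma isClosed_setOf_eval_eq_zero (g : MvPolynomial σ ℂ) :
    @IsClosed _ (zariski σ) {x | eval x g = 0} :=
  isClosed_zariski_iff.2 ⟨{g}, by simp⟩

lemma eval_bind₁ (φ : τ → MvPolynomial σ ℂ) (x : σ → ℂ) (g : MvPolynomial τ ℂ) :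
    eval x (bind₁ φ g) = eval (fun i => eval x (φ i)) g :=
  eval₂Hom_bind₁ _ _ _ _

lemma isIrreducible_iff_isPrime {D : Set (σ → ℂ)} :
    @IsIrreducible _ (zariski σ) D ↔ (vanishingIdeal ℂ D).IsPrime := by
  let := zariski σ
  constructor
  · rintro ⟨⟨x, hx⟩, hD⟩
    rw [isPreirreducible_iff_isClosed_union_isClosed] at hD
    refine ⟨fun h => ?_, fun {g h} hgh => ?_⟩
    · have h1 : (1 : MvPolynomial σ ℂ) ∈ vanishingIdeal ℂ D := h ▸ Submodule.mem_top
      simpa using mem_vanishingIdeal.1 h1 x hx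
    · refine (hD _ _ (isClosed_setOf_eval_eq_zero g) (isClosed_setOf_eval_eq_zero h) ?_).imp
        (fun h => mem_vanishingIdeal.2 h) (fun h => mem_vanishingIdeal.2 h)
      intro y hy
      have := mem_vanishingIdeal.1 hgh y hy
      rwa [map_mul, mul_eq_zero] at this
  · intro hp
    refine ⟨?_, ?_⟩
    · rw [Set.nonempty_iff_ne_empty]
      rintro rfl
      exact hp.ne_top vanishingIdeal_empty
    · rw [isPreirreducible_iff_isClosed_union_isClosed]
      intro Z₁ Z₂ hZ₁ hZ₂ hD
      obtain ⟨S, rfl⟩ := isClosed_zariski_iff.1 hZ₁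
      obtain ⟨T, rfl⟩ := isClosed_zariski_iff.1 hZ₂
      by_contra! hne
      simp only [Set.not_subset, Set.mem_ofPred_eq, not_forall] at hne
      obtain ⟨⟨x, hx, g, hg, hgx⟩, ⟨y, hy, h, hh, hhy⟩⟩ := hne
      have hgh : g * h ∈ vanishingIdeal ℂ D := mem_vanishingIdeal.2 fun z hz => by
        rcases hD hz with h' | h'
        · simp [h' g hg]
        · simp [h' h hh]
      rcases hp.mem_or_mem hgh with h' | h'
      · exact hgx (mem_vanishingIdeal.1 h' x hx)
      · exact hhy (mem_vanishingIdeal.1 h' y hy)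

/-- The vanishing ideal of the image under a polynomial map is the preimage of the vanishing ideal,
hence prime. -/
lemma isIrreducible_image {D : Set (σ → ℂ)} (hD : @IsIrreducible _ (zariski σ) D)
    (φ : τ → MvPolynomial σ ℂ) :
    @IsIrreducible _ (zariski τ) ((fun x i => eval x (φ i)) '' D) := by
  rw [isIrreducible_iff_isPrime] at hD ⊢
  have : vanishingIdeal ℂ ((fun x i => eval x (φ i)) '' D) =
      (vanishingIdeal ℂ D).comap (bind₁ φ) := by
    ext g
    rw [Ideal.mem_comap, mem_vanishingIdeal, mem_vanishingIdeal, Set.forall_mem_image]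
    exact forall₂_congr fun x _ => by rw [eval_bind₁]
  rw [this]
  exact Ideal.comap_isPrime _ _

/-- By Zorn's lemma, since the union of a chain of irreducible sets is irreducible: its vanishing
ideal is the intersection of a chain of prime ideals. -/
lemma exists_component_superset {S D : Set (σ → ℂ)} (hD : @IsIrreducible _ (zariski σ) D)
    (hDS : D ⊆ S) : ∃ C ∈ components S, D ⊆ C := by
  obtain ⟨C, hDC, hC⟩ := zorn_subset_nonempty
    {D | D ⊆ S ∧ @IsIrreducible _ (zariski σ) D} (by
    intro c hc hchain hne
    refine ⟨⋃₀ c, ⟨Set.sUnion_subset fun E hE => (hc hE).1, ?_⟩, fun E hE =>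
      Set.subset_sUnion_of_mem hE⟩
    rw [isIrreducible_iff_isPrime]
    have hI : vanishingIdeal ℂ (⋃₀ c) = sInf (vanishingIdeal ℂ '' c) := by
      ext g
      simp only [mem_vanishingIdeal, Ideal.mem_sInf, Set.mem_sUnion, Set.forall_mem_image]
      exact ⟨fun h E hE x hx => h x ⟨E, hE, hx⟩, fun h x ⟨E, hE, hx⟩ => h hE x hx⟩
    rw [hI]
    refine Ideal.sInf_isPrime_of_isChain (hne.image _) ?_ ?_
    · rintro _ ⟨E, hE, rfl⟩ _ ⟨F, hF, rfl⟩ -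
      exact (hchain.total hE hF).symm.imp vanishingIdeal_anti_mono vanishingIdeal_anti_mono
    · rintro _ ⟨E, hE, rfl⟩
      exact isIrreducible_iff_isPrime.1 (hc hE).2) D ⟨hDS, hD⟩
  exact ⟨C, hC, hDC⟩

lemma zeroLocus_vanishingIdeal_subset_of_isClosed {S D : Set (σ → ℂ)}
    (hS : @IsClosed _ (zariski σ) S) (hDS : D ⊆ S) : zeroLocus ℂ (vanishingIdeal ℂ D) ⊆ S := by
  obtain ⟨T, rfl⟩ := isClosed_zariski_iff.1 hS
  exact fun x hx g hg => mem_zeroLocus.1 hx g (mem_vanishingIdeal.2 fun y hy => hDS hy g hg)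

lemma isIrreducible_zeroLocus [Finite σ] (Q : Ideal (MvPolynomial σ ℂ)) [Q.IsPrime] :
    @IsIrreducible _ (zariski σ) (zeroLocus ℂ Q) := by
  rw [isIrreducible_iff_isPrime, IsPrime.vanishingIdeal_zeroLocus]
  infer_instance

/-- The irreducible components of a closed set are closed: the closure of a component is again an
irreducible subset, so it is not larger. -/
lemma zeroLocus_vanishingIdeal_of_mem_components [Finite σ] {S C : Set (σ → ℂ)}
    (hS : @IsClosed _ (zariski σ) S) (hC : C ∈ components S) :
    zeroLocus ℂ (vanishingIdeal ℂ C) = C := by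
  have hC' : Maximal (fun D => D ⊆ S ∧ @IsIrreducible _ (zariski σ) D) C := hC
  have := isIrreducible_iff_isPrime.1 hC'.prop.2
  exact (hC'.eq_of_subset ⟨zeroLocus_vanishingIdeal_subset_of_isClosed hS hC'.prop.1,
    isIrreducible_zeroLocus _⟩ (zeroLocus_vanishingIdeal_le C)).symm

end Zariski

/-! ### Dimension of finitely generated domains -/

section Dimension

/-- In a polynomial ring in `n` variables over a field, every maximal ideal has height `n`. -/
lemma height_of_isMaximal_mvPolynomial (k : Type*) [Field k] (n : ℕ)
    (M : Ideal (MvPolynomial (Fin n) k)) [hM : M.IsMaximal] : M.height = n := by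
  induction n with
  | zero =>
    have h : M.height ≤ ringKrullDim (MvPolynomial (Fin 0) k) :=
      Ideal.height_le_ringKrullDim_of_ne_top hM.ne_top
    rw [MvPolynomial.ringKrullDim_of_isNoetherianRing] at h
    simpa using h
  | succ n ih =>
    let e := (finSuccEquiv k n).toRingEquiv
    rw [← e.height_map M]
    have : (M.map e).IsMaximal := Ideal.map_isMaximal_of_equiv e
    generalize M.map e = N at this
    have : (N.under (MvPolynomial (Fin n) k)).IsMaximal :=
      Polynomial.isMaximal_comap_C_of_isJacobsonRing N
    have : N.LiesOver (N.under (MvPolynomial (Fin n) k)) := ⟨rfl⟩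
    rw [Polynomial.height_eq_height_add_one (N.under (MvPolynomial (Fin n) k)) N, ih]
    simp

lemma ringKrullDim_le_of_isIntegral (R A : Type*) [CommRing R] [CommRing A] [Algebra R A]
    [Algebra.IsIntegral R A] : ringKrullDim A ≤ ringKrullDim R := by
  refine Order.krullDim_le_of_strictMono (PrimeSpectrum.comap (algebraMap R A)) fun p q hpq => ?_
  exact Ideal.IsIntegral.comap_lt_comap hpq

/-- In a finitely generated domain over a field, every maximal ideal has height at least the
dimension of the ring. -/
lemma ringKrullDim_le_height_of_isMaximal (k A : Type*) [Field k] [CommRing A] [IsDomain A]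
    [Algebra k A] [Algebra.FiniteType k A] (M : Ideal A) [M.IsMaximal] :
    ringKrullDim A ≤ M.height := by
  obtain ⟨s, g, hinj, hint⟩ := exists_integral_inj_algHom_of_fg k A
  let := g.toRingHom.toAlgebra
  have : Algebra.IsIntegral (MvPolynomial (Fin s) k) A := ⟨hint⟩
  have : FaithfulSMul (MvPolynomial (Fin s) k) A :=
    (faithfulSMul_iff_algebraMap_injective _ _).2 hinj
  have : IsNoetherianRing A := Algebra.FiniteType.isNoetherianRing k A
  have hmax : (M.under (MvPolynomial (Fin s) k)).IsMaximal :=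
    Ideal.isMaximal_comap_of_isIntegral_of_isMaximal M
  have h1 : M.height = _ :=
    Ideal.height_eq_height_add_of_liesOver_of_hasGoingDown (M.under (MvPolynomial (Fin s) k)) M
  rw [height_of_isMaximal_mvPolynomial k s] at h1
  calc ringKrullDim A ≤ ringKrullDim (MvPolynomial (Fin s) k) := ringKrullDim_le_of_isIntegral _ _
    _ = ((s : ℕ∞) : WithBot ℕ∞) := by
        rw [MvPolynomial.ringKrullDim_of_isNoetherianRing]; simp
    _ ≤ M.height := by
        rw [h1]
        exact WithBot.coe_le_coe.2 le_self_add

end Dimension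

/-! ### Dimension of irreducible sets -/

section IrreducibleSets

variable {σ : Type*}

/-- Fewer than `dim Y` equations that hold at a point `q` of an irreducible set `Y` cut out on the
closure of `Y` an irreducible set through `q` that is not reduced to `q`. By Krull's height theorem,
a prime minimal over the equations has height at most their number, whereas the maximal ideal of `q`
has height at least `dim Y`. -/
lemma exists_isIrreducible_ne_singleton [Finite σ] {Y : Set (σ → ℂ)}
    (hY : @IsIrreducible _ (zariski σ) Y)
    {q : σ → ℂ} (hq : q ∈ Y) (s : Finset (MvPolynomial σ ℂ)) (hs : ∀ g ∈ s, eval q g = 0)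
    (hdim : (s.card : WithBot ℕ∞) < dim Y) :
    ∃ C, @IsIrreducible _ (zariski σ) C ∧ C ⊆ zeroLocus ℂ (vanishingIdeal ℂ Y) ∧ q ∈ C ∧
      (∀ g ∈ s, ∀ x ∈ C, eval x g = 0) ∧ C ≠ {q} := by
  classical
  rw [isIrreducible_iff_isPrime] at hY
  set I := vanishingIdeal ℂ Y with hI
  have hIq : I ≤ vanishingIdeal ℂ {q} := vanishingIdeal_anti_mono (by simpa using hq)
  set π := Ideal.Quotient.mk I with hπ
  have hker : RingHom.ker π ≤ vanishingIdeal ℂ {q} := by rwa [hπ, Ideal.mk_ker]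
  set M := (vanishingIdeal ℂ {q}).map π with hM
  have hMc : M.comap π = vanishingIdeal ℂ {q} := by
    rw [hM, Ideal.comap_map_of_surjective' _ Ideal.Quotient.mk_surjective, sup_eq_left.2 hker]
  have : M.IsMaximal := Ideal.IsMaximal.map_of_surjective_of_ker_le
    Ideal.Quotient.mk_surjective hker
  have hsM : Ideal.span (s.image π : Set (MvPolynomial σ ℂ ⧸ I)) ≤ M := by
    rw [Ideal.span_le]
    intro y hy
    obtain ⟨g, hg, rfl⟩ := Finset.mem_image.1 hy
    exact Ideal.mem_map_of_mem _ (mem_vanishingIdeal.2 (by simpa using hs g hg))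
  obtain ⟨Q, hQ, hQM⟩ := Ideal.exists_minimalPrimes_le hsM
  have := hQ.isPrime
  have hne : Q ≠ M := by
    intro h
    have h1 := Ideal.height_le_card_of_mem_minimalPrimes_span_finset hQ
    have h2 : dim Y ≤ M.height := ringKrullDim_le_height_of_isMaximal ℂ _ M
    rw [← h] at h2
    refine absurd (hdim.trans_le h2) (not_lt.2 ?_)
    have h3 : Q.height ≤ (s.card : ℕ∞) :=
      h1.trans (by exact_mod_cast Finset.card_image_le)
    exact_mod_cast WithBot.coe_le_coe.2 h3
  have hQq : Q.comap π ≤ vanishingIdeal ℂ {q} := hMc ▸ Ideal.comap_mono hQM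
  refine ⟨zeroLocus ℂ (Q.comap π), isIrreducible_zeroLocus _, zeroLocus_anti_mono ?_, ?_, ?_, ?_⟩
  · intro g hg
    rw [Ideal.mem_comap, hπ, Ideal.Quotient.eq_zero_iff_mem.2 hg]
    exact Q.zero_mem
  · exact mem_zeroLocus.2 fun g hg => mem_vanishingIdeal.1 (hQq hg) q rfl
  · intro g hg x hx
    refine mem_zeroLocus.1 hx g (hQ.1.2 (Ideal.subset_span ?_))
    exact Finset.mem_coe.2 (Finset.mem_image_of_mem π hg)
  · intro h
    have h1 : vanishingIdeal ℂ (zeroLocus ℂ (Q.comap π)) = Q.comap π :=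
      IsPrime.vanishingIdeal_zeroLocus _
    rw [h, ← hMc] at h1
    exact hne (Ideal.comap_injective_of_surjective π Ideal.Quotient.mk_surjective h1.symm)

lemma eq_singleton_of_dim_eq_zero {E : Set (σ → ℂ)} (hE : @IsIrreducible _ (zariski σ) E)
    (hdim : dim E = 0) {p : σ → ℂ} (hp : p ∈ E) : E = {p} := by
  rw [isIrreducible_iff_isPrime] at hE
  have h0 := ringKrullDimZero_iff_ringKrullDim_eq_zero.2 hdim
  have hmax : (vanishingIdeal ℂ E).IsMaximal :=
    Ideal.Quotient.maximal_of_isField _ Ring.KrullDimLE.isField_of_isDomain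
  have heq : vanishingIdeal ℂ E = vanishingIdeal ℂ {p} :=
    hmax.eq_of_le Ideal.IsPrime.ne_top' (vanishingIdeal_anti_mono (by simpa using hp))
  refine Set.Subset.antisymm (fun x hx => ?_) (by simpa using hp)
  ext i
  have : (X i - C (p i) : MvPolynomial σ ℂ) ∈ vanishingIdeal ℂ E := by
    rw [heq, mem_vanishingIdeal]
    simp
  simpa [sub_eq_zero] using mem_vanishingIdeal.1 this x hx

/-- The dimension of an irreducible subset of a hypersurface of `𝔸ⁿ` is a natural number less
than `n`. -/
lemma exists_dim_eq {n : ℕ} {W : Set (Fin n → ℂ)} (hW : @IsIrreducible _ (zariski (Fin n)) W)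
    {F : MvPolynomial (Fin n) ℂ} (hF : F ≠ 0) (hFW : ∀ x ∈ W, eval x F = 0) :
    ∃ j : ℕ, dim W = j ∧ j < n := by
  rw [isIrreducible_iff_isPrime] at hW
  have h0 : 0 ≤ dim W := ringKrullDim_nonneg_of_nontrivial
  have h1 : dim W + 1 ≤ n := by
    have h := ringKrullDim_succ_le_of_surjective (Ideal.Quotient.mk (vanishingIdeal ℂ W))
      Ideal.Quotient.mk_surjective (mem_nonZeroDivisors_of_ne_zero hF)
      (Ideal.Quotient.eq_zero_iff_mem.2 (mem_vanishingIdeal.2 hFW))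
    rw [MvPolynomial.ringKrullDim_of_isNoetherianRing] at h
    simpa [dim] using h
  generalize dim W = d at h0 h1
  induction d using WithBot.recBotCoe with
  | bot => simp at h0
  | coe d =>
    induction d using ENat.recTopCoe with
    | top =>
      have : ((⊤ + 1 : ℕ∞) : WithBot ℕ∞) ≤ ((n : ℕ∞) : WithBot ℕ∞) := h1
      exact absurd (WithBot.coe_le_coe.1 this) (by simp)
    | coe d =>
      refine ⟨d, rfl, ?_⟩
      have : ((d + 1 : ℕ) : WithBot ℕ∞) ≤ (n : ℕ) := by exact_mod_cast h1
      exact_mod_cast this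

end IrreducibleSets

/-! ### Cylinders over a variety -/

section Cylinder

variable {n : ℕ}

@[simp] lemma triple_zero (θ : ℂ) (x : Fin n → ℂ) (s : ℂ) : triple θ x s 0 = θ := rfl

@[simp] lemma triple_succ_castSucc (θ : ℂ) (x : Fin n → ℂ) (s : ℂ) (i : Fin n) :
    triple θ x s i.castSucc.succ = x i := by
  simp [triple, pair]

@[simp] lemma triple_last (θ : ℂ) (x : Fin n → ℂ) (s : ℂ) :
    triple θ x s (Fin.last (n + 1)) = s := by
  rw [← Fin.succ_last]
  simp [triple, pair]

lemma pair_injective {x y : Fin n → ℂ} {s t : ℂ} (h : pair x s = pair y t) : x = y ∧ s = t := by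
  refine ⟨funext fun i => ?_, ?_⟩
  · simpa [pair] using congrFun h i.castSucc
  · simpa [pair] using congrFun h (Fin.last n)

lemma triple_eta (c : Fin (n + 2) → ℂ) :
    triple (c 0) (fun i => c i.castSucc.succ) (c (Fin.last (n + 1))) = c := by
  ext i
  refine Fin.cases ?_ (fun i => Fin.lastCases ?_ (fun i => ?_) i) i
  · simp
  · rw [Fin.succ_last, triple_last]
  · rw [triple_succ_castSucc]

lemma mem_hatV_iff {V : Set (Fin n → ℂ)} {θ : ℂ} {c : Fin (n + 2) → ℂ} :
    c ∈ hatV V θ ↔ c 0 = θ ∧ (fun i : Fin n => c i.castSucc.succ) ∈ V := by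
  constructor
  · rintro ⟨x, s, rfl, hx⟩
    simpa using hx
  · rintro ⟨rfl, hx⟩
    exact ⟨_, _, (triple_eta c).symm, hx⟩

lemma mem_calL_iff {a : Fin (n - 1) × Fin (n + 1) → ℂ} {k : ℕ} {p : Fin n → ℂ} {θ : ℂ}
    {c : Fin (n + 2) → ℂ} :
    c ∈ calL a k p θ ↔ c 0 = θ ∧ ∀ i : Fin (n - 1), i.val < k →
      linVal a i (fun i => c i.castSucc.succ) - (1 - c (Fin.last (n + 1))) * linVal a i p = 0 := by
  constructor
  · rintro ⟨x, s, rfl, hx⟩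
    simpa using hx
  · rintro ⟨rfl, hx⟩
    exact ⟨_, _, (triple_eta c).symm, hx⟩

/-- The substitution of the constants `θ` and `s` for the first and the last variable; evaluation
after it restricts a polynomial to the slice `{θ} × 𝔸ⁿ × {s}`. -/
noncomputable def sliceSubst (n : ℕ) (θ s : ℂ) : Fin (n + 2) → MvPolynomial (Fin n) ℂ :=
  Fin.cons (α := fun _ => MvPolynomial (Fin n) ℂ) (C θ)
    (Fin.snoc (α := fun _ => MvPolynomial (Fin n) ℂ) X (C s))

lemma eval_sliceSubst (θ s : ℂ) (x : Fin n → ℂ) :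
    (fun i => eval x (sliceSubst n θ s i)) = triple θ x s := by
  ext i
  refine Fin.cases ?_ (fun i => Fin.lastCases ?_ (fun i => ?_) i) i <;>
    simp [sliceSubst, triple, pair]

/-- The substitution of the constants `θ` and `x` for all variables but the last; evaluation
after it restricts a polynomial to the line `{(θ, x)} × 𝔸¹`. -/
noncomputable def lineSubst (θ : ℂ) (x : Fin n → ℂ) : Fin (n + 2) → MvPolynomial (Fin 1) ℂ :=
  Fin.cons (α := fun _ => MvPolynomial (Fin 1) ℂ) (C θ)
    (Fin.snoc (α := fun _ => MvPolynomial (Fin 1) ℂ) (fun i => C (x i)) (X 0))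

lemma eval_lineSubst (θ : ℂ) (x : Fin n → ℂ) (t : Fin 1 → ℂ) :
    (fun i => eval t (lineSubst θ x i)) = triple θ x (t 0) := by
  ext i
  refine Fin.cases ?_ (fun i => Fin.lastCases ?_ (fun i => ?_) i) i <;>
    simp [lineSubst, triple, pair]

lemma isIrreducible_hatV {W : Set (Fin n → ℂ)} (hW : @IsIrreducible _ (zariski (Fin n)) W)
    (θ : ℂ) : @IsIrreducible _ (zariski (Fin (n + 2))) (hatV W θ) := by
  obtain ⟨x₀, hx₀⟩ := hW.1
  rw [isIrreducible_iff_isPrime] at hW ⊢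
  refine ⟨fun h => ?_, fun {F G} hFG => ?_⟩
  · have h1 : (1 : MvPolynomial (Fin (n + 2)) ℂ) ∈ vanishingIdeal ℂ (hatV W θ) :=
      h ▸ Submodule.mem_top
    simpa using mem_vanishingIdeal.1 h1 _ ⟨x₀, 0, rfl, hx₀⟩
  · by_contra! hne
    simp only [mem_vanishingIdeal, not_forall] at hne
    obtain ⟨⟨_, ⟨x, s, rfl, hx⟩, hF⟩, ⟨_, ⟨y, t, rfl, hy⟩, hG⟩⟩ := hne
    -- A single point of `W` can serve both factors because `W` is irreducible.
    obtain ⟨w, hw, hFw, hGw⟩ : ∃ w ∈ W, eval (triple θ w s) F ≠ 0 ∧ eval (triple θ w t) G ≠ 0 := by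
      by_contra! hcon
      have hmem : bind₁ (sliceSubst n θ s) F * bind₁ (sliceSubst n θ t) G ∈
          vanishingIdeal ℂ W := mem_vanishingIdeal.2 fun w hw => by
        rw [map_mul, eval_bind₁, eval_bind₁, eval_sliceSubst, eval_sliceSubst, mul_eq_zero]
        exact or_iff_not_imp_left.2 (hcon w hw)
      rcases hW.mem_or_mem hmem with h | h
      · have := mem_vanishingIdeal.1 h x hx
        rw [eval_bind₁, eval_sliceSubst] at this
        exact hF this
      · have := mem_vanishingIdeal.1 h y hy
        rw [eval_bind₁, eval_sliceSubst] at this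
        exact hG this
    -- On the line over `w` both factors are nonzero polynomials in the last coordinate.
    have hzero : bind₁ (lineSubst θ w) F * bind₁ (lineSubst θ w) G = 0 := by
      refine MvPolynomial.funext fun u => ?_
      rw [map_mul, eval_bind₁, eval_bind₁, eval_lineSubst, map_zero, ← map_mul]
      exact mem_vanishingIdeal.1 hFG _ ⟨w, _, rfl, hw⟩
    rcases mul_eq_zero.1 hzero with h | h
    · have := congrArg (eval fun _ => s) h
      rw [eval_bind₁, eval_lineSubst, map_zero] at this
      exact hFw this
    · have := congrArg (eval fun _ => t) h
      rw [eval_bind₁, eval_lineSubst, map_zero] at this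
      exact hGw this

/-- The slice `s = 0` of a cylinder is a copy of its base, cut out by one equation. -/
lemma dim_add_one_le_dim_hatV {W : Set (Fin n → ℂ)}
    (hW : @IsIrreducible _ (zariski (Fin n)) W) (θ : ℂ) : dim W + 1 ≤ dim (hatV W θ) := by
  obtain ⟨x₀, hx₀⟩ := hW.1
  have hprime := isIrreducible_iff_isPrime.1 (isIrreducible_hatV hW θ)
  let φ : (MvPolynomial (Fin (n + 2)) ℂ ⧸ vanishingIdeal ℂ (hatV W θ)) →+*
      (MvPolynomial (Fin n) ℂ ⧸ vanishingIdeal ℂ W) :=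
    Ideal.quotientMap _ (bind₁ (sliceSubst n θ 0)).toRingHom fun g hg => by
      refine mem_vanishingIdeal.2 fun x hx => ?_
      change eval x (bind₁ (sliceSubst n θ 0) g) = 0
      rw [eval_bind₁, eval_sliceSubst]
      exact mem_vanishingIdeal.1 hg _ ⟨x, 0, rfl, hx⟩
  have hφ : Function.Surjective φ := by
    refine Ideal.quotientMap_surjective fun g => ?_
    refine ⟨rename (fun i : Fin n => i.castSucc.succ) g, ?_⟩
    refine MvPolynomial.funext fun x => ?_
    change eval x (bind₁ (sliceSubst n θ 0) _) = _
    rw [eval_bind₁, eval_sliceSubst, eval_rename]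
    congr 2
    ext i
    simp
  refine ringKrullDim_succ_le_of_surjective φ hφ
    (r := Ideal.Quotient.mk _ (X (Fin.last (n + 1)))) (mem_nonZeroDivisors_of_ne_zero ?_) ?_
  · intro h
    have := mem_vanishingIdeal.1 (Ideal.Quotient.eq_zero_iff_mem.1 h) _ ⟨x₀, 1, rfl, hx₀⟩
    simp at this
  · refine Ideal.Quotient.eq_zero_iff_mem.2 (mem_vanishingIdeal.2 fun x hx => ?_)
    change eval x (bind₁ (sliceSubst n θ 0) _) = _
    rw [eval_bind₁, eval_sliceSubst]
    simp

end Cylinder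

/-! ### Projection to the line -/

section Line

/-- An irreducible set that meets `s = 0` and does not project dominantly onto the `s`-line lies in
`s = 0`. -/
lemma last_eq_zero_of_not_dense {n : ℕ} {D : Set (Fin (n + 2) → ℂ)}
    (hD : @IsIrreducible _ (zariski (Fin (n + 2))) D)
    (hdense : @closure _ (zariski (Fin 1)) (projS '' D) ≠ Set.univ)
    {q : Fin (n + 2) → ℂ} (hq : q ∈ D) (hq0 : q (Fin.last (n + 1)) = 0) :
    ∀ c ∈ D, c (Fin.last (n + 1)) = 0 := by
  obtain ⟨h, hne, hvan⟩ : ∃ h : MvPolynomial (Fin 1) ℂ, h ≠ 0 ∧ ∀ c ∈ D, eval (projS c) h = 0 := by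
    let := zariski (Fin 1)
    obtain ⟨S, hS⟩ := isClosed_zariski_iff.1 (isClosed_closure (s := projS '' D))
    obtain ⟨t, ht⟩ := (Set.ne_univ_iff_exists_notMem _).1 hdense
    rw [hS] at ht
    simp only [Set.mem_ofPred_eq, not_forall] at ht
    obtain ⟨g, hg, hgt⟩ := ht
    refine ⟨g, fun h => hgt (by simp [h]), fun c hc => ?_⟩
    have : projS c ∈ closure (projS '' D) := subset_closure ⟨c, hc, rfl⟩
    rw [hS] at this
    exact this g hg
  -- As a polynomial in one variable, `h` is a power of `X` times a polynomial with nonzero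
  -- constant term.
  let e : MvPolynomial (Fin 1) ℂ →+* Polynomial ℂ := (aeval fun _ => Polynomial.X).toRingHom
  have he : ∀ (t : Fin 1 → ℂ) (g : MvPolynomial (Fin 1) ℂ), (e g).eval (t 0) = eval t g := by
    intro t g
    induction g using MvPolynomial.induction_on with
    | C a => simp [e]
    | add p q hp hq => simp [hp, hq]
    | mul_X p i hp =>
      rw [map_mul, Polynomial.eval_mul, hp, map_mul]
      simp [e, Subsingleton.elim i 0]
  have hne' : e h ≠ 0 := fun h0 => hne (MvPolynomial.funext fun t => by rw [← he, h0]; simp)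
  obtain ⟨u, hu, hnd⟩ := Polynomial.exists_eq_pow_rootMultiplicity_mul_and_not_dvd (e h) hne' 0
  set m := (e h).rootMultiplicity 0
  rw [map_zero, sub_zero] at hu hnd
  have hu0 : u.eval 0 ≠ 0 := by
    rwa [← Polynomial.coeff_zero_eq_eval_zero, Ne, ← Polynomial.X_dvd_iff]
  rw [isIrreducible_iff_isPrime] at hD
  let x : MvPolynomial (Fin (n + 2)) ℂ := X (Fin.last (n + 1))
  have hx : ∀ (c : Fin (n + 2) → ℂ) (v : Polynomial ℂ),
      eval c (Polynomial.aeval x v) = v.eval (c (Fin.last (n + 1))) := by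
    intro c v
    induction v using Polynomial.induction_on with
    | C a => simp [MvPolynomial.algebraMap_eq]
    | add p q hp hq => simp [hp, hq]
    | monomial n a => simp [x, MvPolynomial.algebraMap_eq]
  have hmem : x ^ m * Polynomial.aeval x u ∈ vanishingIdeal ℂ D := by
    refine mem_vanishingIdeal.2 fun c hc => ?_
    have h1 := hvan c hc
    rw [← he, hu] at h1
    simpa [hx, x, projS] using h1
  rcases hD.mem_or_mem hmem with h1 | h1
  · intro c hc
    simpa [x] using mem_vanishingIdeal.1 (hD.mem_of_pow_mem _ h1) c hc
  · have := mem_vanishingIdeal.1 h1 q hq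
    rw [hx, hq0] at this
    exact absurd this hu0

end Line

/-! ### The fiber of the homotopy at `s = 0` -/

section Homotopy

variable {n : ℕ} {V : Set (Fin n → ℂ)} {a : Fin (n - 1) × Fin (n + 1) → ℂ} {k : ℕ}
  {p : Fin n → ℂ}

/-- The polynomial `ℓ_i(x) - (1 - s) ℓ_i(p)` in the variables `(θ, x, s)`. -/
noncomputable def homotopyEq (a : Fin (n - 1) × Fin (n + 1) → ℂ) (p : Fin n → ℂ)
    (i : Fin (n - 1)) : MvPolynomial (Fin (n + 2)) ℂ :=
  C (a (i, 0)) + ∑ j : Fin n, C (a (i, j.succ)) * X j.castSucc.succ -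
    (1 - X (Fin.last (n + 1))) * C (linVal a i p)

lemma eval_homotopyEq (i : Fin (n - 1)) (c : Fin (n + 2) → ℂ) :
    eval c (homotopyEq a p i) =
      linVal a i (fun i => c i.castSucc.succ) - (1 - c (Fin.last (n + 1))) * linVal a i p := by
  simp [homotopyEq, linVal, map_sum]

/-- The `x`-coordinates of a point of the homotopy at `s = 0` lie on the linear variety
through `p`. -/
lemma mem_linZero_of_mem_calL {θ : ℂ} {c : Fin (n + 2) → ℂ} (hc : c ∈ calL a k p θ)
    (h0 : c (Fin.last (n + 1)) = 0) : (fun i : Fin n => c i.castSucc.succ) ∈ linZero a k p := by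
  intro i hi
  simpa [h0] using (mem_calL_iff.1 hc).2 i hi

/-- The implication from `p ∈ V_k` to `(p, 0) ∈ Z_p`. Over a `k`-dimensional component of `V`, `k`
equations leave an irreducible set of positive dimension through `(p, 0)`. It is not contained in
`s = 0`, because the solutions there have dimension `0`. -/
theorem triple_mem_Zpt_of_mem_equiComponent (hV : @IsClosed _ (zariski (Fin n)) V)
    (h3 : H3 V a k p) (θ : ℂ) (hp : p ∈ equiComponent V k) : triple θ p 0 ∈ Zpt V a k p θ := by
  classical
  obtain ⟨W, ⟨hW, hdim⟩, hpW⟩ := hp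
  have hW' : Maximal (fun D => D ⊆ V ∧ @IsIrreducible _ (zariski (Fin n)) D) W := hW
  have hWirr := hW'.prop.2
  have hWclosed := zeroLocus_vanishingIdeal_of_mem_components hV hW
  have hq : triple θ p 0 ∈ hatV W θ := ⟨p, 0, rfl, hpW⟩
  let s : Finset (MvPolynomial (Fin (n + 2)) ℂ) :=
    (Finset.univ.filter fun i : Fin (n - 1) => i.val < k).image (homotopyEq a p)
  have hs : ∀ g ∈ s, eval (triple θ p 0) g = 0 := by
    intro g hg
    obtain ⟨i, -, rfl⟩ := Finset.mem_image.1 hg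
    simp [eval_homotopyEq]
  have hcard : s.card ≤ k := by
    refine Finset.card_image_le.trans ?_
    have h := Finset.card_le_card_of_injOn
      (s := Finset.univ.filter fun i : Fin (n - 1) => i.val < k) (t := Finset.range k)
      Fin.val (by simp +contextual [Set.MapsTo])
      Fin.val_injective.injOn
    simpa using h
  have hlt : (s.card : WithBot ℕ∞) < dim (hatV W θ) := by
    refine lt_of_lt_of_le ?_ (dim_add_one_le_dim_hatV hWirr θ)
    rw [hdim]
    exact_mod_cast Nat.lt_succ_of_le hcard
  obtain ⟨C, hCirr, hCY, hqC, hCs, hCne⟩ :=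
    exists_isIrreducible_ne_singleton (isIrreducible_hatV hWirr θ) hq s hs hlt
  have hCW : C ⊆ hatV W θ := by
    intro c hc
    have hc' := mem_zeroLocus.1 (hCY hc)
    refine mem_hatV_iff.2 ⟨?_, ?_⟩
    · have := hc' (X 0 - MvPolynomial.C θ) (mem_vanishingIdeal.2 fun y hy => by
        simp [(mem_hatV_iff.1 hy).1])
      simpa [sub_eq_zero] using this
    · rw [← hWclosed]
      refine mem_zeroLocus.2 fun g hg => ?_
      have := hc' (rename (fun i : Fin n => i.castSucc.succ) g) (mem_vanishingIdeal.2 fun y hy => by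
        rw [eval_rename]
        exact mem_vanishingIdeal.1 hg _ (mem_hatV_iff.1 hy).2)
      rwa [eval_rename] at this
  have hCL : C ⊆ calL a k p θ := by
    intro c hc
    refine mem_calL_iff.2 ⟨(mem_hatV_iff.1 (hCW hc)).1, fun i hi => ?_⟩
    rw [← eval_homotopyEq]
    exact hCs _ (Finset.mem_image_of_mem _ (by simpa using hi)) c hc
  have hCV : C ⊆ hatV V θ := fun c hc =>
    mem_hatV_iff.2 ⟨(mem_hatV_iff.1 (hCW hc)).1, hW'.prop.1 (mem_hatV_iff.1 (hCW hc)).2⟩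
  obtain ⟨E, hE, hCE⟩ := exists_component_superset hCirr (Set.subset_inter hCV hCL)
  refine ⟨E, ⟨hE, ?_⟩, hCE hqC⟩
  by_contra hdense
  have hC0 : ∀ c ∈ C, c (Fin.last (n + 1)) = 0 := by
    refine last_eq_zero_of_not_dense hCirr (fun h => hdense ?_) hqC (triple_last ..)
    let := zariski (Fin 1)
    exact Set.eq_univ_of_univ_subset (h ▸ closure_mono (Set.image_mono hCE))
  -- The `x`-coordinates of `C` lie in the `0`-dimensional set `V_k ∩ L_{0,p}`, so `C` is a point.
  have hD : @IsIrreducible _ (zariski (Fin n)) ((fun c (i : Fin n) => c i.castSucc.succ) '' C) := by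
    simpa using isIrreducible_image hCirr fun i : Fin n => X i.castSucc.succ
  have hDsub : (fun c (i : Fin n) => c i.castSucc.succ) '' C ⊆
      equiComponent V k ∩ linZero a k p := by
    rintro _ ⟨c, hc, rfl⟩
    exact ⟨⟨W, ⟨hW, hdim⟩, (mem_hatV_iff.1 (hCW hc)).2⟩,
      mem_linZero_of_mem_calL (hCL hc) (hC0 c hc)⟩
  obtain ⟨B, hB, hDB⟩ := exists_component_superset hD hDsub
  have hpD : p ∈ (fun c (i : Fin n) => c i.castSucc.succ) '' C := ⟨_, hqC, by simp⟩
  rcases h3.1 k le_rfl with h | h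
  · exact (h ▸ hDsub hpD : p ∈ (∅ : Set (Fin n → ℂ)))
  · have hB' : Maximal (fun D => D ⊆ equiComponent V k ∩ linZero a k p ∧
      @IsIrreducible _ (zariski (Fin n)) D) B := hB
    have hBp := eq_singleton_of_dim_eq_zero hB'.prop.2 (by simpa using h B hB) (hDB hpD)
    refine hCne (Set.Subset.antisymm (fun c hc => ?_) (by simpa using hqC))
    have hx : (fun i : Fin n => c i.castSucc.succ) = p := by
      have := hDB ⟨c, hc, rfl⟩
      rwa [hBp] at this
    rw [Set.mem_singleton_iff, ← triple_eta c, hx, hC0 c hc, (mem_hatV_iff.1 (hCW hc)).1]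

/-- The coefficients of the family `ℓ_i - (1 - s) ℓ_i(p)`, as polynomials in `s`. -/
noncomputable def shiftCoeff (a : Fin (n - 1) × Fin (n + 1) → ℂ) (p : Fin n → ℂ)
    (t : Fin (n - 1) × Fin (n + 1)) : MvPolynomial (Fin 1) ℂ :=
  if t.2 = 0 then C (a t) - (1 - X 0) * C (linVal a t.1 p) else C (a t)

lemma linVal_shiftCoeff (u : Fin 1 → ℂ) (i : Fin (n - 1)) (x : Fin n → ℂ) :
    linVal (fun t => eval u (shiftCoeff a p t)) i x =
      linVal a i x - (1 - u 0) * linVal a i p := by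
  simp only [linVal, shiftCoeff, if_true, Fin.succ_ne_zero, if_false, eval_C, map_sub, map_mul,
    eval_X, map_one]
  ring

/-- The converse implication: a point `(p, 0) ∈ Z_p` lies over a component of `V` of dimension at
least `k`. A dominant family of solutions on a component of smaller dimension would give, for
almost all `s`, a solution of a system with generic coefficients. -/
theorem exists_mem_equiComponent_of_triple_mem_Zpt {F : MvPolynomial (Fin n) ℂ} (hF : F ≠ 0)
    (hFV : ∀ x ∈ V, eval x F = 0) {U : Set (Fin (n - 1) × Fin (n + 1) → ℂ)}
    (hU : @IsOpen _ (zariski _) U) (haU : a ∈ U) (h1 : ∀ b ∈ U, H1 V b k) {θ : ℂ}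
    (hp : triple θ p 0 ∈ Zpt V a k p θ) : ∃ j, k ≤ j ∧ j < n ∧ p ∈ equiComponent V j := by
  obtain ⟨E, ⟨hE, hdense⟩, hpE⟩ := hp
  have hE' : Maximal (fun D => D ⊆ hatV V θ ∩ calL a k p θ ∧
    @IsIrreducible _ (zariski (Fin (n + 2))) D) E := hE
  have hD : @IsIrreducible _ (zariski (Fin n)) ((fun c (i : Fin n) => c i.castSucc.succ) '' E) := by
    simpa using isIrreducible_image hE'.prop.2 fun i : Fin n => X i.castSucc.succ
  have hDV : (fun c (i : Fin n) => c i.castSucc.succ) '' E ⊆ V := by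
    rintro _ ⟨c, hc, rfl⟩
    exact (mem_hatV_iff.1 (hE'.prop.1 hc).1).2
  obtain ⟨W, hW, hDW⟩ := exists_component_superset hD hDV
  have hW' : Maximal (fun D => D ⊆ V ∧ @IsIrreducible _ (zariski (Fin n)) D) W := hW
  obtain ⟨j, hj, hjn⟩ := exists_dim_eq hW'.prop.2 hF fun x hx => hFV x (hW'.prop.1 hx)
  have hWj : W ⊆ equiComponent V j := Set.subset_sUnion_of_mem ⟨hW, hj⟩
  refine ⟨j, ?_, hjn, hWj (hDW ⟨_, hpE, by simp⟩)⟩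
  by_contra! hjk
  -- `G` vanishes outside `U` but not at the given coefficients, which occur at `s = 1`.
  obtain ⟨G, hGU, hGa⟩ : ∃ G : MvPolynomial (Fin (n - 1) × Fin (n + 1)) ℂ,
      (∀ b ∉ U, eval b G = 0) ∧ eval a G ≠ 0 := by
    let := zariski (Fin (n - 1) × Fin (n + 1))
    obtain ⟨S, hS⟩ := isClosed_zariski_iff.1 hU.isClosed_compl
    have ha : a ∉ Uᶜ := by simpa using haU
    rw [hS] at ha
    simp only [Set.mem_ofPred_eq, not_forall] at ha
    obtain ⟨G, hG, hGa⟩ := ha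
    refine ⟨G, fun b hb => ?_, hGa⟩
    have hb' : b ∈ Uᶜ := hb
    rw [hS] at hb'
    exact hb' G hG
  have hvan : projS '' E ⊆ {u | eval u (bind₁ (shiftCoeff a p) G) = 0} := by
    rintro _ ⟨c, hc, rfl⟩
    change eval (projS c) (bind₁ (shiftCoeff a p) G) = 0
    rw [eval_bind₁]
    refine hGU _ fun hb => ?_
    have hempty := (h1 _ hb).2 j hjk
    refine (hempty ▸ ⟨hWj (hDW ⟨c, hc, rfl⟩), fun i hi => ?_⟩ :
      (fun i : Fin n => c i.castSucc.succ) ∈ (∅ : Set (Fin n → ℂ)))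
    rw [linVal_shiftCoeff]
    exact (mem_calL_iff.1 (hE'.prop.1 hc).2).2 i hi
  have hone : (fun _ => 1) ∈ {u : Fin 1 → ℂ | eval u (bind₁ (shiftCoeff a p) G) = 0} := by
    let := zariski (Fin 1)
    refine closure_minimal hvan (isClosed_setOf_eval_eq_zero _) ?_
    rw [hdense]
    trivial
  refine hGa ?_
  change eval (fun _ => 1) (bind₁ (shiftCoeff a p) G) = 0 at hone
  rw [eval_bind₁] at hone
  have hcoeff : (fun t => eval (fun _ => 1) (shiftCoeff a p t)) = a := by
    funext t
    rw [shiftCoeff]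
    split_ifs <;> simp
  rwa [hcoeff] at hone

/-- By `H4`, only the homotopy started from `p` can reach `(p, 0)`. -/
lemma pair_mem_projPi_Zset_iff {P : Finset (Fin n → ℂ)} {θ : (Fin n → ℂ) → ℂ} (hp : p ∈ P)
    (h4 : ∀ p' ∈ P, H4 P a k p') :
    pair p 0 ∈ projPi '' Zset V P θ a k ↔ triple (θ p) p 0 ∈ Zpt V a k p (θ p) := by
  constructor
  · rintro ⟨c, hc, hcp⟩
    simp only [Zset, Set.mem_iUnion] at hc
    obtain ⟨p', hp', E, ⟨hE, hdense⟩, hcE⟩ := hc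
    have hE' : Maximal (fun D => D ⊆ hatV V (θ p') ∩ calL a k p' (θ p') ∧
      @IsIrreducible _ (zariski (Fin (n + 2))) D) E := hE
    have hcL := (hE'.prop.1 hcE).2
    -- `id` keeps `hcL` in the context.
    obtain ⟨x, s, rfl, -⟩ := id hcL
    obtain ⟨rfl, rfl⟩ := pair_injective hcp
    have hmem := mem_linZero_of_mem_calL hcL (triple_last ..)
    simp only [triple_succ_castSucc] at hmem
    obtain rfl : x = p' := by
      by_contra hne
      exact h4 p' hp' x hp hne hmem
    exact ⟨E, ⟨hE, hdense⟩, hcE⟩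
  · intro h
    exact ⟨_, Set.mem_biUnion (show p ∈ (P : Set _) from hp) h, rfl⟩

end Homotopy

/-! ### Varieties defined over the rationals -/

section Variety

variable {n m : ℕ}

lemma mem_variety_iff {f : Fin m → MvPolynomial (Fin n) ℚ} {x : Fin n → ℂ} :
    x ∈ variety f ↔ ∀ j, eval x (map (algebraMap ℚ ℂ) (f j)) = 0 := by
  simp only [variety, Set.mem_ofPred_eq, eval_map, aeval_def]

lemma isClosed_variety (f : Fin m → MvPolynomial (Fin n) ℚ) :
    @IsClosed _ (zariski (Fin n)) (variety f) := by
  refine isClosed_zariski_iff.2 ⟨Set.range fun j => map (algebraMap ℚ ℂ) (f j), ?_⟩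
  ext x
  simp [mem_variety_iff]

/-- The equivalence for a single `k`. The assumption on larger dimensions stops at `n - 1`, so it is
vacuous for `k = n - 1`. -/
lemma mem_equiComponent_variety_iff {f : Fin m → MvPolynomial (Fin n) ℚ} (hf : ∃ j, f j ≠ 0)
    {P : Finset (Fin n → ℂ)} (θ : (Fin n → ℂ) → ℂ) {a : Fin (n - 1) × Fin (n + 1) → ℂ}
    (ha : Generic (variety f) P a) {p : Fin n → ℂ} (hp : p ∈ P) {k : ℕ} (hk : 1 ≤ k)
    (hkn : k ≤ n - 1) (hpk : ∀ j, k < j → j < n → p ∉ equiComponent (variety f) j) :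
    p ∈ equiComponent (variety f) k ↔ pair p 0 ∈ projPi '' Zset (variety f) P θ a k := by
  obtain ⟨i, hi⟩ := hf
  obtain ⟨U, hU, haU, hH⟩ := ha.h12
  have hF : map (algebraMap ℚ ℂ) (f i) ≠ 0 :=
    (map_ne_zero_iff _ (map_injective _ (algebraMap ℚ ℂ).injective)).2 hi
  rw [pair_mem_projPi_Zset_iff hp fun p' hp' => ha.h4 p' hp' k hk hkn]
  refine ⟨triple_mem_Zpt_of_mem_equiComponent (isClosed_variety f) (ha.h3 p hp k hk hkn) (θ p),
    fun h => ?_⟩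
  obtain ⟨j, hkj, hjn, hj⟩ := exists_mem_equiComponent_of_triple_mem_Zpt hF
    (fun x hx => mem_variety_iff.1 hx i) hU haU (fun b hb => (hH b hb k hk hkn).1) h
  obtain rfl | hlt := hkj.eq_or_lt
  · exact hj
  · exact absurd hj (hpk j hlt hjn)

end Variety

end WitnessPoints

theorem mainTheorem5 {n m : ℕ} (hn : 2 ≤ n)
    (f : Fin m → MvPolynomial (Fin n) ℚ) (hf : ∃ j, f j ≠ 0)
    (P : Finset (Fin n → ℂ)) (hP : (P : Set (Fin n → ℂ)) ⊆ WitnessPoints.variety f)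
    (θ : (Fin n → ℂ) → ℂ) (hθ : Set.InjOn θ (P : Set (Fin n → ℂ)))
    (a : Fin (n - 1) × Fin (n + 1) → ℚ)
    (ha : WitnessPoints.Generic (WitnessPoints.variety f) P (fun t => (a t : ℂ))) :
    ∀ p ∈ P,
      (p ∈ WitnessPoints.equiComponent (WitnessPoints.variety f) (n - 1) ↔
        WitnessPoints.pair p 0 ∈ WitnessPoints.projPi ''
          WitnessPoints.Zset (WitnessPoints.variety f) P θ (fun t => (a t : ℂ)) (n - 1)) ∧
      ∀ k, 1 ≤ k → k ≤ n - 1 →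
        p ∉ (⋃ j > k, WitnessPoints.equiComponent (WitnessPoints.variety f) j) →
        (p ∈ WitnessPoints.equiComponent (WitnessPoints.variety f) k ↔
          WitnessPoints.pair p 0 ∈ WitnessPoints.projPi ''
            WitnessPoints.Zset (WitnessPoints.variety f) P θ (fun t => (a t : ℂ)) k) := by
  intro p hp
  exact ⟨WitnessPoints.mem_equiComponent_variety_iff hf θ ha hp (by omega) le_rfl
      fun j h1 h2 => by omega,
    fun k hk hkn hpk => WitnessPoints.mem_equiComponent_variety_iff hf θ ha hp hk hkn
      fun j hkj _ hj => hpk (Set.mem_biUnion hkj hj)⟩
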